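/- **Theorem.** Let $\lambda,\mu,\rho_e,\rho_b,\kappa,\omega$ be real constants with $2\lambda+3\mu>0$, $\mu\neq 0$ and $\rho_e,\rho_b,\kappa,\omega>0$. Let $-\pi<\theta_m<\theta_M<\pi$ with $\theta_M-\theta_m<\pi$, let $h,M>0$, let $B_h\subset\mathbb R^2$ be the open disk of radius $h$ centred at $0$, and let $$S_h=\{(r\cos\theta,r\sin\theta):\ 0<r<h,\ \theta_m<\theta<\theta_M\},$$ $$\Gamma_h^-=\{(r\cos\theta_m,r\sin\theta_m):\ 0\le r<h\},\qquad \Gamma_h^+=\{(r\cos\theta_M,r\sin\theta_M):\ 0\le r<h\}.$$ Let $\Omega\subset\mathbb R^3$ be a bounded Lipschitz domain with $$(B_h\times(-M,M))\cap\Omega=S_h\times(-M,M),$$ and let $\Gamma\subseteq\partial\Omega$ contain $\Gamma_h^\pm\times(-M,M)$. Let $(v,\mathbf u)\in H^1(\Omega)\times H^1(\Omega)^3$, real- or complex-valued and not both zero, be a pair of transmission eigenfunctions, that is, $$\mu\Delta\mathbf u+(\lambda+\mu)\nabla\nabla\cdot\mathbf u+\omega^2\rho_e\mathbf u=\mathbf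 0,\qquad \nabla\cdot(\rho_b^{-1}\nabla v)+\omega^2\kappa^{-1}v=0\qquad\text{in }\Omega$$ in the sense of distributions, and $$\mathbf u\cdot\nu-\frac1{\rho_b\omega^2}\nabla v\cdot\nu=0,\qquad T_\nu\mathbf u+v\nu=\mathbf 0\qquad\text{on }\Gamma$$ in the weak sense, that is, through Green's formula with test functions in $C_c^\infty(\mathbb R^3)$ whose support meets $\partial\Omega$ only in $\Gamma$. Here $\nu$ is the exterior unit normal, $T_\nu\mathbf u=\lambda(\nabla\cdot\mathbf u)\nu+2\mu(\nabla^s\mathbf u)\nu$ and $\nabla^s\mathbf u=\frac12(\nabla\mathbf u+\nabla\mathbf u^{t})$. Suppose that $$\mathbf u\in C^{1,\alpha_1}(\overline{S_h}\times[-M,M])^3\quad\text{and}\quad v\in C^{\alpha_2}(\overline{S_h}\times[-M,M])$$ for some $\alpha_1,\alpha_2\in(0,1)$. Let $\mathbf p=(0,0,x_3)$ with $x_3\in(-M,M)$ be any point of the edge (for instance $\mathbf p=\mathbf 0$). Then: (a) $\nabla^s\mathbf u(\mathbf p)=\operatorname{diag}\big(\partial_1u_1(\mathbf p),\partial_2u_2(\mathbf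 p),\partial_3u_3(\mathbf p)\big)$. (b) If $\partial_3u_3(\mathbf p)=0$, then $v(\mathbf p)=-2(\lambda+\mu)\,\partial_1u_1(\mathbf p)$. (c) If $\partial_3u_3(\mathbf p)=0$ and $\partial_1u_1(\mathbf p)=0$, then $v(\mathbf p)=0$. (d) If $\partial_3u_3(\mathbf p)=\partial_1u_1(\mathbf p)=0$ and moreover $\partial_2u_1(\mathbf p)=0$ and $\partial_3u_1(\mathbf p)=\partial_3u_2(\mathbf p)=0$, then $\nabla\mathbf u(\mathbf p)=\mathbf 0$. -/

import Mathlib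

open MeasureTheory Set
open scoped ContDiff NNReal

noncomputable section

namespace AcoustoElastic

/-- Physical space `ℝ³` with its Euclidean norm. -/
abbrev E3 : Type := EuclideanSpace ℝ (Fin 3)

/-- The `j`-th coordinate vector. -/
def e (j : Fin 3) : E3 := EuclideanSpace.single j 1

/-! ### Domains -/

/-- A bounded Lipschitz domain: bounded, open, connected, and near each boundary point, in a
suitable Cartesian coordinate system `A`, the open region strictly above the graph of a Lipschitz
function. -/
structure IsBoundedLipschitzDomain (Ω : Set E3) : Prop where
  isOpen : IsOpen Ω
  isConnected : IsConnected Ω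
  isBounded : Bornology.IsBounded Ω
  lipschitz : ∀ p ∈ frontier Ω, ∃ (A : E3 ≃ₗᵢ[ℝ] E3) (r : ℝ) (C : ℝ≥0)
    (g : EuclideanSpace ℝ (Fin 2) → ℝ), 0 < r ∧ LipschitzWith C g ∧
      ∀ x ∈ Metric.ball p r, (x ∈ Ω ↔ g (!₂[A x 0, A x 1]) < A x 2)

/-- The solid edge corner `S_h × (-M, M)`, where `S_h` is the open planar sector of radius `h`
with polar angles between `θm` and `θM`. -/
def edgeCorner (θm θM h M : ℝ) : Set E3 :=
  {x | (∃ r ∈ Ioo 0 h, ∃ θ ∈ Ioo θm θM, x 0 = r * Real.cos θ ∧ x 1 = r * Real.sin θ) ∧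
    x 2 ∈ Ioo (-M) M}

/-- The cylinder `B_h × (-M, M)` over the planar disk `B_h` centred at the origin. -/
def cylinder (h M : ℝ) : Set E3 :=
  {x | x 0 ^ 2 + x 1 ^ 2 < h ^ 2 ∧ x 2 ∈ Ioo (-M) M}

/-- The flat face `Γ_h × (-M, M)` over the half-line of polar angle `θ` cut off at radius `h`
(the edge is included). -/
def face (θ h M : ℝ) : Set E3 :=
  {x | (∃ r ∈ Ico 0 h, x 0 = r * Real.cos θ ∧ x 1 = r * Real.sin θ) ∧ x 2 ∈ Ioo (-M) M}

variable {𝕜 : Type*} [RCLike 𝕜]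

/-! ### Weak derivatives and weak normal components -/

/-- Partial derivative `∂_j ψ` of a smooth test function. -/
def pd (j : Fin 3) (ψ : E3 → ℝ) (x : E3) : ℝ := fderiv ℝ ψ x (e j)

/-- `∫_Ω (d ψ + w · ∇ψ)`. If `d = div w`, this is by Green's formula the boundary
integral of `(w · ν) ψ` over `∂Ω`, with `ν` the exterior unit normal; it is the usual meaning of
that boundary integral for `w, d` merely in `L²(Ω)`. -/
def normalPairing (Ω : Set E3) (w : Fin 3 → E3 → 𝕜) (d : E3 → 𝕜) (ψ : E3 → ℝ) : 𝕜 :=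
  ∫ x in Ω, (ψ x • d x + ∑ j, pd j ψ x • w j x)

/-- `div w = d` in `Ω` in the sense of distributions: tested with all `ψ ∈ C_c^∞(Ω)`. -/
def HasWeakDiv (Ω : Set E3) (w : Fin 3 → E3 → 𝕜) (d : E3 → 𝕜) : Prop :=
  ∀ ψ : E3 → ℝ, ContDiff ℝ ∞ ψ → HasCompactSupport ψ → tsupport ψ ⊆ Ω →
    normalPairing Ω w d ψ = 0

/-- The vector field `f e_i`. -/
def coordField (i : Fin 3) (f : E3 → 𝕜) : Fin 3 → E3 → 𝕜 := fun j x => if j = i then f x else 0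

/-- `f ∈ H¹(Ω)` with weak gradient `Df = (∂_1 f, ∂_2 f, ∂_3 f)`. -/
structure IsH1 (Ω : Set E3) (f : E3 → 𝕜) (Df : Fin 3 → E3 → 𝕜) : Prop where
  memLp : MemLp f 2 (volume.restrict Ω)
  memLp_grad : ∀ j, MemLp (Df j) 2 (volume.restrict Ω)
  weakDeriv : ∀ j, HasWeakDiv Ω (coordField j f) (Df j)

/-- A test function for a boundary condition on `Γ ⊆ ∂Ω`: smooth and compactly supported in
`ℝ³`, with support meeting `∂Ω` only in `Γ`. -/
def IsBoundaryTest (Ω Γ : Set E3) (ψ : E3 → ℝ) : Prop :=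
  ContDiff ℝ ∞ ψ ∧ HasCompactSupport ψ ∧ tsupport ψ ∩ frontier Ω ⊆ Γ

/-! ### The acoustic-elastic transmission eigenvalue problem -/

/-- The divergence `∑ ∂_k u_k`, where `Du i j` stands for `∂_j u_i`. -/
def divergence (Du : Fin 3 → Fin 3 → E3 → 𝕜) (x : E3) : 𝕜 := ∑ k, Du k k x

/-- The `i`-th row of `μ ∇u + (λ+μ) (div u) I`; its divergence is the `i`-th component of the
Lamé operator `μ Δu + (λ+μ) ∇ div u`. -/
def lameFlux (lam mu : ℝ) (Du : Fin 3 → Fin 3 → E3 → 𝕜) (i : Fin 3) : Fin 3 → E3 → 𝕜 :=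
  fun j x => mu • Du i j x + (if j = i then (lam + mu) • divergence Du x else 0)

/-- The `i`-th row of the stress `λ (div u) I + 2 μ ∇ˢu`; its normal component is the `i`-th
component of the traction `T_ν u`. -/
def stress (lam mu : ℝ) (Du : Fin 3 → Fin 3 → E3 → 𝕜) (i : Fin 3) : Fin 3 → E3 → 𝕜 :=
  fun j x => (if j = i then lam • divergence Du x else 0)
    + (2 * mu) • ((1 / 2 : ℝ) • (Du i j x + Du j i x))

/-- `(v, u) ∈ H¹(Ω) × H¹(Ω)³`, with weak gradients `Dv` and `Du` (`Du i j = ∂_j u_i`), solves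
* `L_{λ,μ} u + ω² ρ_e u = 0` and `∇·(ρ_b⁻¹ ∇v) + ω² κ⁻¹ v = 0` in `Ω`,
* `u·ν - (ρ_b ω²)⁻¹ ∇v·ν = 0` and `T_ν u + v ν = 0` on `Γ`,
the equations being understood in the sense of distributions and the boundary conditions in the
weak sense. (By the two equations, `div ∇v = -ω² ρ_b κ⁻¹ v` and the divergence of the stress is
`-ω² ρ_e u`.) -/
structure SolvesTransmission (Ω Γ : Set E3) (lam mu rhoe rhob kappa omega : ℝ)
    (v : E3 → 𝕜) (Dv : Fin 3 → E3 → 𝕜)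
    (u : Fin 3 → E3 → 𝕜) (Du : Fin 3 → Fin 3 → E3 → 𝕜) : Prop where
  h1_v : IsH1 Ω v Dv
  h1_u : ∀ i, IsH1 Ω (u i) (Du i)
  lame : ∀ i, HasWeakDiv Ω (lameFlux lam mu Du i) (fun x => -((omega ^ 2 * rhoe) • u i x))
  helmholtz : HasWeakDiv Ω (fun j x => rhob⁻¹ • Dv j x) (fun x => -((omega ^ 2 * kappa⁻¹) • v x))
  normal : ∀ ψ, IsBoundaryTest Ω Γ ψ →
    normalPairing Ω u (divergence Du) ψ
      - (1 / (rhob * omega ^ 2)) •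
        normalPairing Ω Dv (fun x => -((omega ^ 2 * rhob * kappa⁻¹) • v x)) ψ = 0
  traction : ∀ i, ∀ ψ, IsBoundaryTest Ω Γ ψ →
    normalPairing Ω (stress lam mu Du i) (fun x => -((omega ^ 2 * rhoe) • u i x)) ψ
      + normalPairing Ω (coordField i v) (Dv i) ψ = 0

/-- `(v, u)` is a pair of transmission eigenfunctions: a nontrivial solution. -/
def IsTransmissionEigenpair (Ω Γ : Set E3) (lam mu rhoe rhob kappa omega : ℝ)
    (v : E3 → 𝕜) (u : Fin 3 → E3 → 𝕜) : Prop :=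
  (∃ Dv Du, SolvesTransmission Ω Γ lam mu rhoe rhob kappa omega v Dv u Du) ∧
    ¬ ∀ᵐ x ∂(volume.restrict Ω), v x = 0 ∧ ∀ i, u i x = 0

/-! ### Hölder classes and derivatives up to the boundary -/

/-- `f ∈ C^{1,α}(K)` for a compact convex set `K` with nonempty interior. -/
def IsC1Holder (α : ℝ≥0) (K : Set E3) (f : E3 → 𝕜) : Prop :=
  ContDiffOn ℝ 1 f K ∧ ∃ C : ℝ≥0, HolderOnWith C α (fderivWithin ℝ f K) K

/-- `f ∈ C^α(K)` for a compact set `K`. -/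
def IsHolder (α : ℝ≥0) (K : Set E3) (f : E3 → 𝕜) : Prop :=
  ∃ C : ℝ≥0, HolderOnWith C α f K

/-- The gradient matrix `(∇u)_{ij} = ∂_j u_i` at a point of `K`, with one-sided derivatives
taken within `K`. -/
def gradMatrix (K : Set E3) (u : Fin 3 → E3 → 𝕜) (p : E3) : Matrix (Fin 3) (Fin 3) 𝕜 :=
  Matrix.of fun i j => fderivWithin ℝ (u i) K p (e j)

/-- The strain `∇ˢu = (∇u + (∇u)ᵗ) / 2`. -/
def strain (K : Set E3) (u : Fin 3 → E3 → 𝕜) (p : E3) : Matrix (Fin 3) (Fin 3) 𝕜 :=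
  (1 / 2 : ℝ) • (gradMatrix K u p + (gradMatrix K u p).transpose)

end AcoustoElastic

end

noncomputable section

open Filter Topology

namespace AcoustoElastic

variable {𝕜 : Type*} [RCLike 𝕜]

/-! The theorem is local at the edge. Row `i` of the total stress `σ + v I` has the integrable weak
divergence `-ω² ρ_e u_i + ∂_i v`, and the traction condition says that its normal component vanishes
weakly on both faces. Since `u` is `C¹` and `v` is continuous up to the edge, this should hold
pointwise at an edge point `p`. The two face normals are independent because `0 < θM - θm < π`, so
the entries of `σ + v I` in columns `0` and `1` vanish at `p`. The rest is linear algebra: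
off-diagonal entries are `μ (J i j + J j i)`, and the diagonal ones give `J 0 0 = J 1 1` and then `v
p`.

The passage from weak to pointwise is `normal_component_eq_zero`. Near `p` the region is `{a > 0, b
> 0}` with `a`, `b` linear. The weak identity is tested with `φ (1 - S(n b))`, where `φ` is a bump
at `p` and `S` a smooth step from `0` to `1`. This cutoff tends to `0` inside the region, so all
terms in which `S` is not differentiated disappear as `n → ∞`. What remains is the integral of `∇b ·
w` against the layer `φ n S'(n b)` concentrating on the face `{b = 0}`. By
`exists_le_integral_layer` the mass of this layer stays bounded below, so a nonzero value of `∇b ·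
w` at `p` would contradict the limit. `IsH1.ae_eq_fderiv` allows the weak derivatives to be replaced
by the classical ones, which are continuous up to the edge. -/

/-! ### Smooth steps and the mass of a boundary layer. -/

lemma deriv_smoothTransition_nonneg (t : ℝ) : 0 ≤ deriv Real.smoothTransition t :=
  Real.smoothTransition.monotone.deriv_nonneg

lemma deriv_smoothTransition_of_neg {t : ℝ} (ht : t < 0) : deriv Real.smoothTransition t = 0 := by
  have h : Real.smoothTransition =ᶠ[𝓝 t] fun _ => (0 : ℝ) := by
    filter_upwards [Iio_mem_nhds ht] with s hs
    exact Real.smoothTransition.zero_of_nonpos (le_of_lt hs)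
  rw [h.deriv_eq, deriv_const]

lemma continuous_deriv_smoothTransition : Continuous (deriv Real.smoothTransition) :=
  (Real.smoothTransition.contDiff (n := 1)).continuous_deriv le_rfl

lemma deriv_smoothTransition_of_nonpos {t : ℝ} (ht : t ≤ 0) :
    deriv Real.smoothTransition t = 0 := by
  have hcl : IsClosed {s : ℝ | deriv Real.smoothTransition s = 0} :=
    isClosed_eq continuous_deriv_smoothTransition continuous_const
  have hsub : closure (Iio (0 : ℝ)) ⊆ {s : ℝ | deriv Real.smoothTransition s = 0} :=
    hcl.closure_subset_iff.2 fun s hs => deriv_smoothTransition_of_neg hs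
  rw [closure_Iio] at hsub
  exact hsub ht

lemma hasDerivAt_smoothTransition (t : ℝ) :
    HasDerivAt Real.smoothTransition (deriv Real.smoothTransition t) t :=
  ((Real.smoothTransition.contDiff (n := 1)).differentiable one_ne_zero t).hasDerivAt

/-- The integrand is the derivative of `S(N (β + τ))` in `τ`; over the interval the argument runs
from a value `≤ 0` to a value `≥ 1`, so the whole step is crossed. -/
lemma lintegral_layer {N β T : ℝ} (hN : 0 < N) (h0 : 0 ≤ β) (hT : β ≤ T) (hNT : 1 ≤ N * T) :
    ∫⁻ τ in Ioc (-T) T, ENNReal.ofReal (N * deriv Real.smoothTransition (N * (β + τ))) = 1 := by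
  have hcont : Continuous fun τ : ℝ => N * deriv Real.smoothTransition (N * (β + τ)) :=
    continuous_const.mul (continuous_deriv_smoothTransition.comp (by fun_prop))
  have hder : ∀ τ : ℝ, HasDerivAt (fun τ => Real.smoothTransition (N * (β + τ)))
      (N * deriv Real.smoothTransition (N * (β + τ))) τ := by
    intro τ
    have h1 : HasDerivAt (fun τ : ℝ => N * (β + τ)) N τ := by
      simpa using ((hasDerivAt_id τ).const_add β).const_mul N
    have h2 := (hasDerivAt_smoothTransition (N * (β + τ))).comp τ h1
    rw [mul_comm]
    exact h2
  rw [← ofReal_integral_eq_lintegral_ofReal]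
  · rw [← intervalIntegral.integral_of_le (by linarith),
      intervalIntegral.integral_eq_sub_of_hasDerivAt (fun τ _ => hder τ)
        (hcont.intervalIntegrable _ _),
      Real.smoothTransition.one_of_one_le (by nlinarith),
      Real.smoothTransition.zero_of_nonpos (mul_nonpos_of_nonneg_of_nonpos hN.le (by linarith))]
    simp
  · exact (hcont.intervalIntegrable (-T) T).1
  · exact ae_of_all _ fun τ => mul_nonneg hN.le (deriv_smoothTransition_nonneg _)

/-- A boundary layer of thickness `1 / n` along a face of a wedge, with density `n`, has mass
bounded below. -/
theorem exists_le_integral_layer {Ω : Set E3} {p d c : E3} (a b : E3 →L[ℝ] ℝ)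
    (hap : a p = 0) (hbp : b p = 0) (hda : a d = 0) (hdb : b d = 1) (hac : 0 < a c) (hbc : 0 < b c)
    (hΩ : MeasurableSet Ω) {R : ℝ} (hR : 0 < R)
    (hloc : ∀ x ∈ Metric.ball p R, 0 < a x → 0 < b x → x ∈ Ω)
    {φ : E3 → ℝ} (hφc : Continuous φ) (hφs : HasCompactSupport φ) (hφ0 : ∀ x, 0 ≤ φ x)
    (hφ1 : ∀ x ∈ Metric.ball p R, φ x = 1) :
    ∃ m > 0, ∀ᶠ n : ℕ in atTop,
      m ≤ ∫ x in Ω, φ x * (n * deriv Real.smoothTransition (n * b x)) := by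
  obtain ⟨T, hT, hTd⟩ : ∃ T : ℝ, 0 < T ∧ T * ‖d‖ < R / 2 := by
    refine ⟨R / 2 / (‖d‖ + 1), by positivity, ?_⟩
    rw [div_mul_eq_mul_div, div_lt_iff₀ (by positivity)]
    nlinarith [norm_nonneg d]
  -- A fixed open piece of the wedge. `T` is small enough that translates of `E` by `τ • d` with
  -- `|τ| ≤ T` stay in `ball p R`; since `a d = 0` and `b d = 1`, such a translation keeps `a` and
  -- shifts `b` by `τ`.
  set E : Set E3 := {x | x ∈ Metric.ball p (R / 2) ∧ 0 < a x ∧ 0 < b x ∧ b x < T} with hE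
  have hEo : IsOpen E := by
    refine Metric.isOpen_ball.inter ((isOpen_lt continuous_const a.continuous).inter
      ((isOpen_lt continuous_const b.continuous).inter (isOpen_lt b.continuous continuous_const)))
  have hEn : E.Nonempty := by
    have h1 : ∀ᶠ t : ℝ in 𝓝[>] 0, p + t • c ∈ Metric.ball p (R / 2) := by
      have : Tendsto (fun t : ℝ => p + t • c) (𝓝[>] 0) (𝓝 p) := by
        have h : Continuous fun t : ℝ => p + t • c := by fun_prop
        simpa using (h.tendsto 0).mono_left nhdsWithin_le_nhds
      exact this (Metric.ball_mem_nhds p (by positivity))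
    have h2 : ∀ᶠ t : ℝ in 𝓝[>] 0, t * b c < T := by
      have : Tendsto (fun t : ℝ => t * b c) (𝓝[>] 0) (𝓝 0) := by
        have h : Continuous fun t : ℝ => t * b c := by fun_prop
        simpa using (h.tendsto 0).mono_left nhdsWithin_le_nhds
      exact this (Iio_mem_nhds hT)
    obtain ⟨t, ⟨ht1, ht2⟩, ht⟩ := ((h1.and h2).and self_mem_nhdsWithin).exists
    have ht : 0 < t := ht
    refine ⟨p + t • c, ht1, ?_, ?_, ?_⟩ <;> simp [hap, hbp] <;> first | positivity | exact ht2
  have hEpos : 0 < volume E := hEo.measure_pos volume hEn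
  have hEfin : volume E ≠ ⊤ :=
    (lt_of_le_of_lt (measure_mono fun x hx => hx.1) measure_ball_lt_top).ne
  refine ⟨(volume E).toReal / (2 * T), div_pos (ENNReal.toReal_pos hEpos.ne' hEfin) (by positivity),
    ?_⟩
  obtain ⟨N, hN⟩ := exists_nat_gt (1 / T)
  filter_upwards [eventually_ge_atTop (max N 1)] with n hn
  have hn0 : (0 : ℝ) < n := by
    have : 1 ≤ n := le_trans (le_max_right _ _) hn
    exact_mod_cast this
  have hnT : 1 ≤ (n : ℝ) * T := by
    have : (N : ℝ) ≤ n := by exact_mod_cast le_trans (le_max_left _ _) hn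
    rw [div_lt_iff₀ hT] at hN
    nlinarith
  set K : ℝ → ENNReal := fun t => ENNReal.ofReal (n * deriv Real.smoothTransition (n * t)) with hK
  have hKc : Continuous K := ENNReal.continuous_ofReal.comp
    (continuous_const.mul (continuous_deriv_smoothTransition.comp (by fun_prop)))
  set F : E3 → ℝ := fun x => φ x * (n * deriv Real.smoothTransition (n * b x)) with hF
  have hFc : Continuous F := hφc.mul
    (continuous_const.mul (continuous_deriv_smoothTransition.comp (by fun_prop)))
  have hF0 : ∀ x, 0 ≤ F x := fun x =>
    mul_nonneg (hφ0 x) (mul_nonneg hn0.le (deriv_smoothTransition_nonneg _))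
  have hFi : Integrable F := hFc.integrable_of_hasCompactSupport hφs.mul_right
  set G : E3 → ENNReal := Ω.indicator fun x => ENNReal.ofReal (F x) with hG
  have hGm : Measurable G :=
    (ENNReal.measurable_ofReal.comp hFc.measurable).indicator hΩ
  have hpt : ∀ τ ∈ Ioc (-T) T, ∀ x, E.indicator (fun x => K (b x + τ)) x ≤ G (x + τ • d) := by
    intro τ hτ x
    by_cases hx : x ∈ E
    · rw [indicator_of_mem hx]
      have hbx : b (x + τ • d) = b x + τ := by simp [hdb]
      -- A translate may leave the wedge through `{b = 0}`, but there the layer density is zero.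
      rcases le_or_gt (b x + τ) 0 with hle | hlt
      · simp only [hK]
        rw [deriv_smoothTransition_of_nonpos (mul_nonpos_of_nonneg_of_nonpos hn0.le hle)]
        simp
      · have hball : x + τ • d ∈ Metric.ball p R := by
          have h1 := hx.1
          rw [Metric.mem_ball, dist_eq_norm] at h1 ⊢
          have h2 : ‖τ • d‖ ≤ T * ‖d‖ := by
            rw [norm_smul, Real.norm_eq_abs]
            exact mul_le_mul_of_nonneg_right (abs_le.2 ⟨hτ.1.le, hτ.2⟩) (norm_nonneg d)
          calc ‖x + τ • d - p‖ = ‖(x - p) + τ • d‖ := by congr 1; abel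
            _ ≤ ‖x - p‖ + ‖τ • d‖ := norm_add_le _ _
            _ < R := by linarith
        have hmem : x + τ • d ∈ Ω :=
          hloc _ hball (by simpa [hda] using hx.2.1) (by rw [hbx]; exact hlt)
        simp only [hG, indicator_of_mem hmem, hF, hK, hφ1 _ hball, hbx, one_mul, le_refl]
    · rw [indicator_of_notMem hx]; exact zero_le
  -- Each point of `E` meets the layer with total mass `1` as `τ` varies; exchanging the integrals,
  -- each of the translates contributes at most `∫ G` by translation invariance.
  have key : volume E ≤ ENNReal.ofReal (2 * T) * ∫⁻ x, G x := by
    calc volume E = ∫⁻ x in E, ∫⁻ τ in Ioc (-T) T, K (b x + τ) := by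
          rw [setLIntegral_congr_fun hEo.measurableSet
            (fun x hx => lintegral_layer hn0 hx.2.2.1.le hx.2.2.2.le hnT)]
          simp
      _ = ∫⁻ τ in Ioc (-T) T, ∫⁻ x in E, K (b x + τ) := by
          apply lintegral_lintegral_swap
          apply Measurable.aemeasurable
          exact (hKc.comp (by fun_prop : Continuous fun q : E3 × ℝ => b q.1 + q.2)).measurable
      _ ≤ ∫⁻ _ in Ioc (-T) T, ∫⁻ x, G x := by
          refine setLIntegral_mono' measurableSet_Ioc fun τ hτ => ?_
          rw [← lintegral_indicator hEo.measurableSet, ← lintegral_add_right_eq_self G (τ • d)]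
          exact lintegral_mono (hpt τ hτ)
      _ = ENNReal.ofReal (2 * T) * ∫⁻ x, G x := by
          rw [setLIntegral_const, Real.volume_Ioc, mul_comm]
          congr 2; ring
  have hGF : ∫⁻ x, G x = ENNReal.ofReal (∫ x in Ω, F x) := by
    rw [hG, lintegral_indicator hΩ, ofReal_integral_eq_lintegral_ofReal hFi.integrableOn
      (ae_of_all _ hF0)]
  rw [hGF, ← ENNReal.ofReal_mul (by positivity)] at key
  rw [div_le_iff₀ (by positivity), mul_comm]
  have hnn : 0 ≤ 2 * T * ∫ x in Ω, F x :=
    mul_nonneg (by positivity) (integral_nonneg hF0)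
  calc (volume E).toReal ≤ (ENNReal.ofReal (2 * T * ∫ x in Ω, F x)).toReal :=
        ENNReal.toReal_mono ENNReal.ofReal_ne_top key
    _ = _ := ENNReal.toReal_ofReal hnn

/-! ### From weak to pointwise vanishing of a normal component. -/

lemma continuous_pd {ψ : E3 → ℝ} (hψ : ContDiff ℝ ∞ ψ) (j : Fin 3) : Continuous (pd j ψ) :=
  (hψ.continuous_fderiv (by simp)).clm_apply continuous_const

lemma pd_of_notMem_tsupport {ψ : E3 → ℝ} {x : E3} (hx : x ∉ tsupport ψ) (j : Fin 3) :
    pd j ψ x = 0 := by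
  have h : x ∉ tsupport (fderiv ℝ ψ) := fun h => hx (tsupport_fderiv_subset ℝ h)
  rw [pd, image_eq_zero_of_notMem_tsupport h]; rfl

lemma hasCompactSupport_pd {ψ : E3 → ℝ} (hs : HasCompactSupport ψ) (j : Fin 3) :
    HasCompactSupport (pd j ψ) :=
  HasCompactSupport.intro hs fun _ hx => pd_of_notMem_tsupport hx j

lemma integrable_smul_of_hasCompactSupport {μ : Measure E3} {f : E3 → 𝕜} (hf : Integrable f μ)
    {ψ : E3 → ℝ} (hψ : Continuous ψ) (hs : HasCompactSupport ψ) :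
    Integrable (fun x => ψ x • f x) μ := by
  obtain ⟨C, hC⟩ := hs.exists_bound_of_continuous hψ
  exact hf.bdd_smul C hψ.aestronglyMeasurable (ae_of_all _ hC)

lemma integrable_normalPairing {Ω : Set E3} {w : Fin 3 → E3 → 𝕜} {g : E3 → 𝕜}
    (hw : ∀ j, IntegrableOn (w j) Ω) (hg : IntegrableOn g Ω) {ψ : E3 → ℝ} (hψ : ContDiff ℝ ∞ ψ)
    (hs : HasCompactSupport ψ) :
    IntegrableOn (fun x => ψ x • g x + ∑ j, pd j ψ x • w j x) Ω :=
  (integrable_smul_of_hasCompactSupport hg hψ.continuous hs).add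
    (integrable_finsetSum _ fun j _ =>
      integrable_smul_of_hasCompactSupport (hw j) (continuous_pd hψ j) (hasCompactSupport_pd hs j))

lemma pd_mul_one_sub_smoothTransition {φ : E3 → ℝ} (hφ : ContDiff ℝ ∞ φ) (b : E3 →L[ℝ] ℝ) (N : ℝ)
    (j : Fin 3) (x : E3) :
    pd j (fun x => φ x * (1 - Real.smoothTransition (N * b x))) x =
      pd j φ x * (1 - Real.smoothTransition (N * b x)) -
        φ x * (N * deriv Real.smoothTransition (N * b x)) * b (e j) := by
  have h1 : HasFDerivAt φ (fderiv ℝ φ x) x := (hφ.differentiable (by simp) x).hasFDerivAt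
  have h2 : HasFDerivAt (fun x => N * b x) (N • (b : E3 →L[ℝ] ℝ)) x :=
    b.hasFDerivAt.const_mul N
  have h3 := ((hasDerivAt_smoothTransition (N * b x)).comp_hasFDerivAt x h2).const_sub 1
  have h4 := h1.mul h3
  have h5 : fderiv ℝ (fun x => φ x * (1 - Real.smoothTransition (N * b x))) x = _ := h4.fderiv
  rw [pd, h5]
  simp [pd]
  ring

/-- If a vector field on a region that is locally a wedge `{a > 0, b > 0}` has weakly an integrable
divergence and vanishing normal component on the boundary, and is continuous up to a point of the
edge, then its component normal to the face `{b = 0}` vanishes there. -/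
theorem normal_component_eq_zero {Ω U : Set E3} {p d c : E3} (a b : E3 →L[ℝ] ℝ)
    (hap : a p = 0) (hbp : b p = 0) (hda : a d = 0) (hdb : b d = 1) (hac : 0 < a c) (hbc : 0 < b c)
    (hΩ : MeasurableSet Ω) (hU : U ∈ 𝓝 p) (hloc : ∀ x ∈ U, x ∈ Ω ↔ 0 < a x ∧ 0 < b x)
    {w w' : Fin 3 → E3 → 𝕜} {g : E3 → 𝕜}
    (hw : ∀ j, IntegrableOn (w j) Ω) (hg : IntegrableOn g Ω)
    (hww' : ∀ j, ∀ᵐ x ∂volume.restrict Ω, x ∈ U → w j x = w' j x)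
    (hcont : ∀ j, ContinuousWithinAt (w' j) Ω p)
    (hweak : ∀ ψ : E3 → ℝ, ContDiff ℝ ∞ ψ → HasCompactSupport ψ → tsupport ψ ⊆ U →
      normalPairing Ω w g ψ = 0) :
    ∑ j, b (e j) • w' j p = 0 := by
  by_contra hne
  set F : E3 → 𝕜 := fun x => ∑ j, b (e j) • w' j x with hF
  set Fw : E3 → 𝕜 := fun x => ∑ j, b (e j) • w j x with hFw
  have hz : 0 < ‖F p‖ := norm_pos_iff.2 hne
  have hFcont : ContinuousWithinAt F Ω p :=
    tendsto_finsetSum _ fun j _ => (hcont j).const_smul (b (e j))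
  obtain ⟨R, hR, hRU, hRF⟩ : ∃ R > 0, Metric.ball p R ⊆ U ∧
      ∀ x ∈ Metric.ball p R, x ∈ Ω → ‖F x - F p‖ ≤ ‖F p‖ / 2 := by
    obtain ⟨R₁, hR₁, h₁⟩ := Metric.mem_nhds_iff.1 hU
    obtain ⟨R₂, hR₂, h₂⟩ := Metric.continuousWithinAt_iff.1 hFcont (‖F p‖ / 2) (by positivity)
    refine ⟨min R₁ R₂, lt_min hR₁ hR₂, (Metric.ball_subset_ball (min_le_left _ _)).trans h₁, ?_⟩
    intro x hx hxΩ
    rw [← dist_eq_norm]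
    exact (h₂ hxΩ (lt_of_lt_of_le hx (min_le_right _ _))).le
  let φ : ContDiffBump p := ⟨R / 4, R / 2, by positivity, by linarith⟩
  have hφd : ContDiff ℝ ∞ (φ : E3 → ℝ) := φ.contDiff
  have hφs : HasCompactSupport (φ : E3 → ℝ) := φ.hasCompactSupport
  have hφt : tsupport (φ : E3 → ℝ) ⊆ Metric.ball p R := by
    rw [φ.tsupport_eq]
    exact Metric.closedBall_subset_ball (by show R / 2 < R; linarith)
  obtain ⟨m, hm, hmass⟩ := exists_le_integral_layer a b hap hbp hda hdb hac hbc hΩ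
    (R := R / 4) (by positivity)
    (fun x hx hax hbx => (hloc x (hRU (Metric.ball_subset_ball (by linarith) hx))).2 ⟨hax, hbx⟩)
    hφd.continuous hφs (fun x => φ.nonneg)
    (fun x hx => φ.one_of_mem_closedBall (Metric.ball_subset_closedBall hx))
  set H : E3 → 𝕜 := fun x => φ x • g x + ∑ j, pd j φ x • w j x with hH
  have hHi : IntegrableOn H Ω := integrable_normalPairing hw hg hφd hφs
  have hFwi : IntegrableOn Fw Ω := integrable_finsetSum _ fun j _ => (hw j).smul (b (e j))
  set lay : ℕ → E3 → ℝ := fun n x => φ x * (n * deriv Real.smoothTransition (n * b x)) with hlay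
  have hlayc : ∀ n, Continuous (lay n) := fun n => hφd.continuous.mul
    (continuous_const.mul (continuous_deriv_smoothTransition.comp (by fun_prop)))
  have hlays : ∀ n, HasCompactSupport (lay n) := fun n => hφs.mul_right
  have hlay0 : ∀ n x, 0 ≤ lay n x := fun n x =>
    mul_nonneg φ.nonneg (mul_nonneg n.cast_nonneg (deriv_smoothTransition_nonneg _))
  set cut : ℕ → E3 → ℝ := fun n x => 1 - Real.smoothTransition (n * b x) with hcut
  have hcutc : ∀ n, Continuous (cut n) := fun n =>
    continuous_const.sub (Real.smoothTransition.continuous.comp (by fun_prop))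
  have hcut1 : ∀ n x, ‖cut n x‖ ≤ 1 := fun n x => by
    rw [Real.norm_eq_abs, abs_le]
    have h1 := Real.smoothTransition.nonneg (n * b x)
    have h2 := Real.smoothTransition.le_one (n * b x)
    constructor <;> simp only [hcut] <;> linarith
  have hcutH : ∀ n, IntegrableOn (fun x => cut n x • H x) Ω := fun n =>
    hHi.bdd_smul 1 (hcutc n).aestronglyMeasurable (ae_of_all _ (hcut1 n))
  have hlayF : ∀ n, IntegrableOn (fun x => lay n x • Fw x) Ω := fun n =>
    integrable_smul_of_hasCompactSupport hFwi (hlayc n) (hlays n)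
  -- The weak identity for `φ (1 - S(n b))`, with the term in which the step is differentiated moved
  -- to one side.
  have heq : ∀ n, ∫ x in Ω, lay n x • Fw x = ∫ x in Ω, cut n x • H x := by
    intro n
    have hψd : ContDiff ℝ ∞ fun x => φ x * (1 - Real.smoothTransition (n * b x)) :=
      hφd.mul (contDiff_const.sub (Real.smoothTransition.contDiff.comp
        (contDiff_const.mul b.contDiff)))
    have h := hweak (fun x => φ x * (1 - Real.smoothTransition (n * b x))) hψd hφs.mul_right
      ((tsupport_mul_subset_left).trans (hφt.trans hRU))
    have h' : (fun x => (φ x * (1 - Real.smoothTransition (n * b x))) • g x +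
        ∑ j, pd j (fun x => φ x * (1 - Real.smoothTransition (n * b x))) x • w j x) =
        fun x => cut n x • H x - lay n x • Fw x := by
      funext x
      simp only [pd_mul_one_sub_smoothTransition hφd, hcut, hH, hlay, hFw, Fin.sum_univ_three]
      module
    rw [normalPairing, h', integral_sub (hcutH n) (hlayF n), sub_eq_zero] at h
    exact h.symm
  have hlim : Tendsto (fun n => ∫ x in Ω, cut n x • H x) atTop (𝓝 0) := by
    have := tendsto_integral_of_dominated_convergence (μ := volume.restrict Ω)
      (F := fun n x => cut n x • H x) (f := fun _ => 0) (fun x => ‖H x‖)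
      (fun n => (hcutH n).aestronglyMeasurable) hHi.norm
      (fun n => ae_of_all _ fun x => by
        rw [norm_smul]
        exact mul_le_of_le_one_left (norm_nonneg _) (hcut1 n x))
      ?_
    · simpa using this
    · rw [ae_restrict_iff' hΩ]
      refine ae_of_all _ fun x hx => ?_
      by_cases hxt : x ∈ tsupport (φ : E3 → ℝ)
      -- Inside the region `b x > 0`, so `S(n b x) = 1` as soon as `n b x ≥ 1`, and the cutoff
      -- vanishes.
      · have hb : 0 < b x := ((hloc x (hRU (hφt hxt))).1 hx).2
        apply tendsto_const_nhds.congr'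
        obtain ⟨N, hN⟩ := exists_nat_gt (1 / b x)
        filter_upwards [eventually_ge_atTop N] with n hn
        have hn' : (N : ℝ) ≤ n := by exact_mod_cast hn
        rw [div_lt_iff₀ hb] at hN
        simp only [hcut]
        rw [Real.smoothTransition.one_of_one_le (by nlinarith)]
        simp
      · have : H x = 0 := by
          simp only [hH, pd_of_notMem_tsupport hxt, image_eq_zero_of_notMem_tsupport hxt]
          simp
        simp [this]
  -- On the support of `φ` inside `Ω`, `Fw` agrees a.e. with `F`, which differs from `F p` by at
  -- most `‖F p‖ / 2`; hence at least half of the mass times `‖F p‖` survives in the integral.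
  have hlow : ∀ᶠ n : ℕ in atTop, m * (‖F p‖ / 2) ≤ ‖∫ x in Ω, cut n x • H x‖ := by
    filter_upwards [hmass] with n hn
    have hli : IntegrableOn (lay n) Ω :=
      ((hlayc n).integrable_of_hasCompactSupport (hlays n)).integrableOn
    have hdiff : ‖∫ x in Ω, (lay n x • Fw x - lay n x • F p)‖ ≤
        ∫ x in Ω, lay n x * (‖F p‖ / 2) := by
      refine norm_integral_le_of_norm_le (hli.mul_const _) ?_
      have hall : ∀ᵐ x ∂volume.restrict Ω, ∀ j, x ∈ U → w j x = w' j x := ae_all_iff.2 hww'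
      filter_upwards [hall, ae_restrict_mem hΩ] with x hx hxΩ
      rw [← smul_sub, norm_smul, Real.norm_of_nonneg (hlay0 n x)]
      by_cases hxt : x ∈ tsupport (φ : E3 → ℝ)
      · have hFF : Fw x = F x := by
          simp only [hFw, hF]
          exact Finset.sum_congr rfl fun j _ => by rw [hx j (hRU (hφt hxt))]
        rw [hFF]
        exact mul_le_mul_of_nonneg_left (hRF x (hφt hxt) hxΩ) (hlay0 n x)
      · have : lay n x = 0 := by
          simp [hlay, image_eq_zero_of_notMem_tsupport hxt]
        simp [this]
    rw [integral_sub (hlayF n) (hli.smul_const _), integral_smul_const, integral_mul_const,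
      heq n] at hdiff
    have h1 : ‖(∫ x in Ω, lay n x) • F p‖ = (∫ x in Ω, lay n x) * ‖F p‖ := by
      rw [norm_smul, Real.norm_of_nonneg (hm.le.trans hn)]
    have h2 := norm_sub_norm_le ((∫ x in Ω, lay n x) • F p) (∫ x in Ω, cut n x • H x)
    rw [norm_sub_rev, h1] at h2
    have hn' : m ≤ ∫ x in Ω, lay n x := hn
    nlinarith [mul_le_mul_of_nonneg_right hn' hz.le]
  have h0 : m * (‖F p‖ / 2) ≤ 0 := by
    have := ge_of_tendsto hlim.norm hlow
    simpa using this
  have : 0 < m * (‖F p‖ / 2) := by positivity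
  linarith

/-! ### Weak and classical derivatives. -/

lemma integrable_smul_of_continuousOn {V : Set E3} {f : E3 → 𝕜} (hf : ContinuousOn f V)
    {ψ : E3 → ℝ} (hψ : Continuous ψ) (hs : HasCompactSupport ψ) (hsV : tsupport ψ ⊆ V) :
    Integrable fun x => ψ x • f x := by
  have h : IntegrableOn (fun x => ψ x • f x) (tsupport ψ) :=
    (hψ.continuousOn.smul (hf.mono hsV)).integrableOn_compact hs
  refine (integrableOn_iff_integrable_of_support_subset ?_).1 h
  exact (Function.support_smul_subset_left _ _).trans (subset_tsupport ψ)

/-- Where an `H¹` function is `C¹`, its weak derivatives are the classical ones. -/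
theorem IsH1.ae_eq_fderiv {Ω V : Set E3} {f : E3 → 𝕜} {Df : Fin 3 → E3 → 𝕜}
    (hf : IsH1 Ω f Df) (hΩb : Bornology.IsBounded Ω) (hV : IsOpen V) (hVΩ : V ⊆ Ω)
    (hC : ContDiffOn ℝ 1 f V) (j : Fin 3) :
    ∀ᵐ x, x ∈ V → Df j x = fderiv ℝ f x (e j) := by
  have : IsFiniteMeasure (volume.restrict Ω) := ⟨by
    rw [Measure.restrict_apply_univ]; exact hΩb.measure_lt_top⟩
  have hDf : IntegrableOn (Df j) Ω := (hf.memLp_grad j).integrable (by norm_num)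
  have hfΩ : IntegrableOn f Ω := hf.memLp.integrable (by norm_num)
  have hd : ContinuousOn (fun x => fderiv ℝ f x (e j)) V :=
    (hC.continuousOn_fderiv_of_isOpen hV le_rfl).clm_apply continuousOn_const
  have hloc : LocallyIntegrableOn (fun x => Df j x - fderiv ℝ f x (e j)) V :=
    (hDf.mono_set hVΩ).locallyIntegrableOn.sub (hd.locallyIntegrableOn hV.measurableSet)
  -- Fundamental lemma of the calculus of variations: against every test function on `V`, both
  -- derivatives integrate to `-∫ ∂_jψ f`.
  have := hV.ae_eq_zero_of_integral_contDiff_smul_eq_zero hloc fun ψ hψ hs hsV => ?_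
  · filter_upwards [this] with x hx hxV
    exact sub_eq_zero.1 (hx hxV)
  have hiD : Integrable fun x => ψ x • fderiv ℝ f x (e j) :=
    integrable_smul_of_continuousOn hd hψ.continuous hs hsV
  have hif : Integrable fun x => pd j ψ x • f x :=
    integrable_smul_of_continuousOn hC.continuousOn (continuous_pd hψ j)
      (hasCompactSupport_pd hs j) (fun x hx => hsV (by
        by_contra hxn
        have hop : (tsupport ψ)ᶜ ∈ 𝓝 x := (isClosed_tsupport ψ).isOpen_compl.mem_nhds hxn
        refine (notMem_tsupport_iff_eventuallyEq.2 ?_) hx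
        filter_upwards [hop] with y hy using pd_of_notMem_tsupport hy j))
  have hiΩ : IntegrableOn (fun x => ψ x • Df j x) Ω :=
    integrable_smul_of_hasCompactSupport hDf hψ.continuous hs
  have hzero : ∀ x, x ∉ Ω → ψ x = 0 := fun x hx =>
    image_eq_zero_of_notMem_tsupport fun h => hx (hVΩ (hsV h))
  have hiΩ' : Integrable fun x => ψ x • Df j x :=
    (integrableOn_iff_integrable_of_support_subset (fun x hx => by
      by_contra hxn
      exact hx (by simp [hzero x hxn]))).1 hiΩ
  have h1 : ∫ x, ψ x • Df j x = - ∫ x, pd j ψ x • f x := by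
    have h := hf.weakDeriv j ψ hψ hs (hsV.trans hVΩ)
    simp only [normalPairing, coordField, smul_ite, smul_zero, Finset.sum_ite_eq',
      Finset.mem_univ, if_true] at h
    rw [setIntegral_eq_integral_of_forall_compl_eq_zero, integral_add hiΩ' hif] at h
    · exact eq_neg_of_add_eq_zero_left h
    · intro x hx
      rw [hzero x hx, pd_of_notMem_tsupport fun h => hx (hVΩ (hsV h))]
      simp
  have h2 : ∫ x, ψ x • fderiv ℝ f x (e j) = - ∫ x, pd j ψ x • f x := by
    refine integral_smul_fderiv_eq_neg_fderiv_smul_of_integrable hif hiD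
      (integrable_smul_of_continuousOn hC.continuousOn hψ.continuous hs hsV)
      (fun x _ => hψ.differentiable (by simp) x) fun x hx => ?_
    exact (hC.differentiableOn one_ne_zero).differentiableAt (hV.mem_nhds (hsV hx))
  simp only [smul_sub]
  rw [integral_sub hiΩ' hiD, h1, h2, sub_self]

/-! ### Geometry of the wedge. -/

/-- The linear form `x ↦ r sin (φ - θ)` in polar coordinates `(r, φ)` around the edge. -/
def angularForm (θ : ℝ) : E3 →L[ℝ] ℝ :=
  Real.cos θ • EuclideanSpace.proj (1 : Fin 3) - Real.sin θ • EuclideanSpace.proj (0 : Fin 3)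

lemma angularForm_apply (θ : ℝ) (x : E3) :
    angularForm θ x = Real.cos θ * x 1 - Real.sin θ * x 0 := by
  simp [angularForm]

lemma isOpen_cylinder (h M : ℝ) : IsOpen (cylinder h M) := by
  have h0 : Continuous fun x : E3 => x 0 := by fun_prop
  have h1 : Continuous fun x : E3 => x 1 := by fun_prop
  have h2 : Continuous fun x : E3 => x 2 := by fun_prop
  exact (isOpen_lt ((h0.pow 2).add (h1.pow 2)) continuous_const).inter (isOpen_Ioo.preimage h2)

/-- An opening below `π` makes the sector an intersection of two half-planes, the form required by
`normal_component_eq_zero`. -/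
lemma edgeCorner_eq {θm θM h M : ℝ} (hθ : θm < θM) (hconvex : θM - θm < Real.pi) (hh : 0 < h) :
    edgeCorner θm θM h M =
      cylinder h M ∩ {x | 0 < angularForm θm x ∧ 0 < -angularForm θM x} := by
  ext x
  simp only [edgeCorner, cylinder, mem_ofPred_eq, mem_inter_iff, angularForm_apply]
  constructor
  · rintro ⟨⟨r, hr, θ, hθ', h0, h1⟩, h2⟩
    have hm : 0 < Real.sin (θ - θm) :=
      Real.sin_pos_of_pos_of_lt_pi (by linarith [hθ'.1]) (by linarith [hθ'.2])
    have hM : 0 < Real.sin (θM - θ) :=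
      Real.sin_pos_of_pos_of_lt_pi (by linarith [hθ'.2]) (by linarith [hθ'.1])
    have hcs := Real.cos_sq_add_sin_sq θ
    refine ⟨⟨?_, h2⟩, ?_, ?_⟩
    · rw [h0, h1]
      have : (r * Real.cos θ) ^ 2 + (r * Real.sin θ) ^ 2 = r ^ 2 := by
        linear_combination r ^ 2 * hcs
      rw [this]
      exact pow_lt_pow_left₀ hr.2 hr.1.le two_ne_zero
    · have := mul_pos hr.1 hm
      rw [Real.sin_sub] at this
      rw [h0, h1]; linarith
    · have := mul_pos hr.1 hM
      rw [Real.sin_sub] at this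
      rw [h0, h1]; linarith
  · rintro ⟨⟨hlt, h2⟩, hm, hM⟩
    refine ⟨?_, h2⟩
    -- `z = exp(-iθm) (x 0 + i x 1)`: after this rotation `arg z` is the angle measured from the
    -- face `θm`, and positivity of the first form is `0 < z.im`.
    set z : ℂ := ⟨Real.cos θm * x 0 + Real.sin θm * x 1, Real.cos θm * x 1 - Real.sin θm * x 0⟩
      with hz
    have hcs := Real.cos_sq_add_sin_sq θm
    have hre : ‖z‖ * Real.cos z.arg = Real.cos θm * x 0 + Real.sin θm * x 1 :=
      Complex.norm_mul_cos_arg z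
    have him : ‖z‖ * Real.sin z.arg = Real.cos θm * x 1 - Real.sin θm * x 0 :=
      Complex.norm_mul_sin_arg z
    have hsq : ‖z‖ ^ 2 = x 0 ^ 2 + x 1 ^ 2 := by
      have := Real.cos_sq_add_sin_sq z.arg
      calc ‖z‖ ^ 2 = (‖z‖ * Real.cos z.arg) ^ 2 + (‖z‖ * Real.sin z.arg) ^ 2 := by
            linear_combination -(‖z‖ ^ 2) * this
        _ = x 0 ^ 2 + x 1 ^ 2 := by
            rw [hre, him]; linear_combination (x 0 ^ 2 + x 1 ^ 2) * hcs
    have hzpos : 0 < ‖z‖ := norm_pos_iff.2 fun h => by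
      have : z.im = 0 := by rw [h]; rfl
      exact hm.ne' this
    have harg0 : 0 < z.arg := by
      have h1 : 0 ≤ z.arg := Complex.arg_nonneg_iff.2 hm.le
      rcases h1.eq_or_lt with h | h
      · rw [← h] at him; simp at him; linarith
      · exact h
    have h0 : x 0 = ‖z‖ * Real.cos (θm + z.arg) := by
      rw [Real.cos_add]
      linear_combination -(Real.cos θm) * hre + Real.sin θm * him - x 0 * hcs
    have h1 : x 1 = ‖z‖ * Real.sin (θm + z.arg) := by
      rw [Real.sin_add]
      linear_combination -(Real.sin θm) * hre - Real.cos θm * him - x 1 * hcs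
    refine ⟨‖z‖, ⟨hzpos, ?_⟩, θm + z.arg, ⟨by linarith, ?_⟩, h0, h1⟩
    · rw [← hsq] at hlt
      exact lt_of_pow_lt_pow_left₀ 2 hh.le hlt
    -- Otherwise `θm + arg z - θM` lies in `[0, π]`, where the sine is nonnegative, against the
    -- second half-plane condition.
    · by_contra hge
      have hs : Real.sin (θm + z.arg - θM) < 0 := by
        have : 0 < ‖z‖ * -Real.sin (θm + z.arg - θM) := by
          rw [Real.sin_sub]
          rw [h0, h1] at hM
          linarith
        have := pos_of_mul_pos_right this hzpos.le
        linarith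
      have := Real.sin_nonneg_of_nonneg_of_le_pi (x := θm + z.arg - θM) (by linarith)
        (by linarith [Complex.arg_le_pi z])
      linarith

lemma eq_mul_cos_sin_of_angularForm_eq_zero {θ : ℝ} {x : E3} (hx : angularForm θ x = 0) :
    ∃ r : ℝ, x 0 = r * Real.cos θ ∧ x 1 = r * Real.sin θ ∧ r ^ 2 = x 0 ^ 2 + x 1 ^ 2 := by
  rw [angularForm_apply] at hx
  have hcs := Real.cos_sq_add_sin_sq θ
  refine ⟨Real.cos θ * x 0 + Real.sin θ * x 1, ?_, ?_, ?_⟩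
  · linear_combination -(x 0) * hcs - Real.sin θ * hx
  · linear_combination -(x 1) * hcs + Real.cos θ * hx
  · linear_combination (x 0 ^ 2 + x 1 ^ 2) * hcs - (Real.cos θ * x 1 - Real.sin θ * x 0) * hx

lemma mem_face {θ h M r : ℝ} {x : E3} (hh : 0 < h) (hx : x ∈ cylinder h M) (hr : 0 ≤ r)
    (h0 : x 0 = r * Real.cos θ) (h1 : x 1 = r * Real.sin θ) (hsq : r ^ 2 = x 0 ^ 2 + x 1 ^ 2) :
    x ∈ face θ h M := by
  refine ⟨⟨r, ⟨hr, ?_⟩, h0, h1⟩, hx.2⟩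
  have := hx.1
  rw [← hsq] at this
  exact lt_of_pow_lt_pow_left₀ 2 hh.le this

/-- A boundary point satisfies both weak inequalities but not both strict ones, so one form
vanishes; the other inequality then selects the correct half of that line. Hence test functions
supported in the cylinder are admissible for the boundary condition. -/
lemma cylinder_inter_frontier_subset {Ω : Set E3} {θm θM h M : ℝ} (hΩ : IsOpen Ω) (hθ : θm < θM)
    (hconvex : θM - θm < Real.pi) (hh : 0 < h)
    (hcorner : cylinder h M ∩ Ω = edgeCorner θm θM h M) :
    cylinder h M ∩ frontier Ω ⊆ face θm h M ∪ face θM h M := by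
  rintro x ⟨hxc, hxf⟩
  have hs : 0 < Real.sin (θM - θm) := Real.sin_pos_of_pos_of_lt_pi (by linarith) hconvex
  rw [edgeCorner_eq hθ hconvex hh] at hcorner
  rw [hΩ.frontier_eq] at hxf
  have hcl : x ∈ closure {x | 0 < angularForm θm x ∧ 0 < -angularForm θM x} := by
    refine closure_mono ?_ ((isOpen_cylinder h M).inter_closure ⟨hxc, hxf.1⟩)
    rw [hcorner]
    exact inter_subset_right
  have hle : 0 ≤ angularForm θm x ∧ 0 ≤ -angularForm θM x := by
    have hclosed : IsClosed {x | 0 ≤ angularForm θm x ∧ 0 ≤ -angularForm θM x} :=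
      (isClosed_le continuous_const (angularForm θm).continuous).inter
        (isClosed_le continuous_const (angularForm θM).continuous.neg)
    exact hclosed.closure_subset_iff.2 (fun y hy => ⟨hy.1.le, hy.2.le⟩) hcl
  have hnot : ¬ (0 < angularForm θm x ∧ 0 < -angularForm θM x) := fun hpos => by
    have : x ∈ cylinder h M ∩ Ω := by rw [hcorner]; exact ⟨hxc, hpos⟩
    exact hxf.2 this.2
  rcases hle.1.eq_or_lt with hm | hm
  · obtain ⟨r, h0, h1, hsq⟩ := eq_mul_cos_sin_of_angularForm_eq_zero hm.symm
    refine Or.inl (mem_face hh hxc ?_ h0 h1 hsq)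
    have := hle.2
    rw [angularForm_apply, h0, h1] at this
    have : 0 ≤ r * Real.sin (θM - θm) := by rw [Real.sin_sub]; linarith
    exact nonneg_of_mul_nonneg_left this hs
  · have hM : angularForm θM x = 0 := by
      by_contra hne
      exact hnot ⟨hm, lt_of_le_of_ne hle.2 fun h => hne (by linarith)⟩
    obtain ⟨r, h0, h1, hsq⟩ := eq_mul_cos_sin_of_angularForm_eq_zero hM
    refine Or.inr (mem_face hh hxc ?_ h0 h1 hsq)
    have := hle.1
    rw [angularForm_apply, h0, h1] at this
    have : 0 ≤ r * Real.sin (θM - θm) := by rw [Real.sin_sub]; linarith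
    exact nonneg_of_mul_nonneg_left this hs

lemma angularForm_apply_ray (θ φ : ℝ) :
    angularForm θ !₂[Real.cos φ, Real.sin φ, 0] = Real.sin (φ - θ) := by
  rw [angularForm_apply, Real.sin_sub]
  simp
  ring

lemma angularForm_apply_edge (θ x₃ : ℝ) : angularForm θ !₂[0, 0, x₃] = 0 := by
  simp [angularForm_apply]

lemma edge_mem_cylinder {h M x₃ : ℝ} (hh : 0 < h) (hx₃ : x₃ ∈ Ioo (-M) M) :
    !₂[0, 0, x₃] ∈ cylinder h M := by
  refine ⟨?_, by simpa using hx₃⟩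
  simpa using pow_pos hh 2

lemma edge_mem_closure_edgeCorner {θm θM h M x₃ : ℝ} (hθ : θm < θM) (hconvex : θM - θm < Real.pi)
    (hh : 0 < h) (hx₃ : x₃ ∈ Ioo (-M) M) :
    !₂[0, 0, x₃] ∈ closure (edgeCorner θm θM h M) := by
  have hs : 0 < Real.sin (θM - θm) := Real.sin_pos_of_pos_of_lt_pi (by linarith) hconvex
  set p : E3 := !₂[0, 0, x₃] with hp
  -- The sum of the two boundary rays points into the wedge: each face's form vanishes on its own
  -- ray and is positive on the other.
  set c : E3 := !₂[Real.cos θm, Real.sin θm, 0] + !₂[Real.cos θM, Real.sin θM, 0] with hc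
  have hlim : Tendsto (fun t : ℝ => p + t • c) (𝓝[>] 0) (𝓝 p) := by
    have h : Continuous fun t : ℝ => p + t • c := by fun_prop
    simpa using (h.tendsto 0).mono_left nhdsWithin_le_nhds
  refine mem_closure_of_tendsto hlim ?_
  filter_upwards [hlim ((isOpen_cylinder h M).mem_nhds (edge_mem_cylinder hh hx₃)),
    self_mem_nhdsWithin] with t ht ht0
  rw [edgeCorner_eq hθ hconvex hh]
  have hts := mul_pos (show 0 < t from ht0) hs
  have hneg : Real.sin (θm - θM) = -Real.sin (θM - θm) := by rw [← Real.sin_neg]; congr 1; ring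
  refine ⟨ht, ?_, ?_⟩
  · rw [map_add, map_smul, hp, angularForm_apply_edge, hc, map_add, angularForm_apply_ray,
      angularForm_apply_ray, sub_self, Real.sin_zero, zero_add, zero_add]
    exact hts
  · rw [map_add, map_smul, hp, angularForm_apply_edge, hc, map_add, angularForm_apply_ray,
      angularForm_apply_ray, sub_self, Real.sin_zero, add_zero, zero_add, hneg, smul_neg, neg_neg]
    exact hts

/-! ### The total stress at the edge. -/

lemma normalPairing_add {Ω : Set E3} {w₁ w₂ : Fin 3 → E3 → 𝕜} {g₁ g₂ : E3 → 𝕜}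
    (hw₁ : ∀ j, IntegrableOn (w₁ j) Ω) (hg₁ : IntegrableOn g₁ Ω)
    (hw₂ : ∀ j, IntegrableOn (w₂ j) Ω) (hg₂ : IntegrableOn g₂ Ω)
    {ψ : E3 → ℝ} (hψ : ContDiff ℝ ∞ ψ) (hs : HasCompactSupport ψ) :
    normalPairing Ω (fun j x => w₁ j x + w₂ j x) (fun x => g₁ x + g₂ x) ψ =
      normalPairing Ω w₁ g₁ ψ + normalPairing Ω w₂ g₂ ψ := by
  rw [normalPairing, normalPairing, normalPairing,
    ← integral_add (integrable_normalPairing hw₁ hg₁ hψ hs)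
      (integrable_normalPairing hw₂ hg₂ hψ hs)]
  congr 1
  funext x
  simp only [smul_add, Finset.sum_add_distrib]
  abel

lemma integrableOn_stress {Ω : Set E3} {Du : Fin 3 → Fin 3 → E3 → 𝕜}
    (hDu : ∀ i j, IntegrableOn (Du i j) Ω) (lam mu : ℝ) (i j : Fin 3) :
    IntegrableOn (stress lam mu Du i j) Ω := by
  refine Integrable.add ?_
    ((((hDu i j).add (hDu j i)).fun_smul (1 / 2 : ℝ)).fun_smul (2 * mu))
  split_ifs
  · exact Integrable.fun_smul lam (integrable_finsetSum _ fun k _ => hDu k k)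
  · exact integrable_zero _ _ _

lemma integrableOn_coordField {Ω : Set E3} {f : E3 → 𝕜} (hf : IntegrableOn f Ω) (i j : Fin 3) :
    IntegrableOn (coordField i f j) Ω := by
  unfold coordField
  split_ifs
  · exact hf
  · exact integrable_zero _ _ _

lemma continuousWithinAt_stress {K : Set E3} {p : E3} {Du : Fin 3 → Fin 3 → E3 → 𝕜}
    (hDu : ∀ i j, ContinuousWithinAt (Du i j) K p) (lam mu : ℝ) (i j : Fin 3) :
    ContinuousWithinAt (stress lam mu Du i j) K p := by
  refine ContinuousWithinAt.add ?_ ((((hDu i j).add (hDu j i)).const_smul _).const_smul _)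
  split_ifs
  · exact ContinuousWithinAt.const_smul (tendsto_finsetSum _ fun k _ => hDu k k) _
  · exact continuousWithinAt_const

lemma continuousWithinAt_coordField {K : Set E3} {p : E3} {f : E3 → 𝕜}
    (hf : ContinuousWithinAt f K p) (i j : Fin 3) :
    ContinuousWithinAt (coordField i f j) K p := by
  unfold coordField
  split_ifs
  · exact hf
  · exact continuousWithinAt_const

/-- Cramer's rule: the two face normals have determinant `sin (θM - θm)`. -/
lemma eq_zero_of_angularForm_eq_zero {θm θM : ℝ} (hs : 0 < Real.sin (θM - θm)) {W : Fin 3 → 𝕜}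
    (hm : ∑ j, angularForm θm (e j) • W j = 0) (hM : ∑ j, (-angularForm θM) (e j) • W j = 0) :
    W 0 = 0 ∧ W 1 = 0 := by
  simp only [Fin.sum_univ_three, neg_apply, angularForm_apply, e] at hm hM
  simp [RCLike.real_smul_eq_coe_mul] at hm hM
  have hs' : ((Real.sin (θM - θm) : ℝ) : 𝕜) ≠ 0 := RCLike.ofReal_ne_zero.2 hs.ne'
  rw [Real.sin_sub] at hs'
  push_cast at hs'
  constructor
  · refine (mul_eq_zero_iff_left hs').1 ?_
    linear_combination (Real.cos θM : 𝕜) * hm + (Real.cos θm : 𝕜) * hM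
  · refine (mul_eq_zero_iff_left hs').1 ?_
    linear_combination (Real.sin θM : 𝕜) * hm + (Real.sin θm : 𝕜) * hM

/-- At a point of the edge, the total stress `σ + v I` annihilates the plane normal to the edge. -/
theorem stress_add_coordField_eq_zero {Ω Γ : Set E3} {θm θM h M : ℝ} (hΩ : IsOpen Ω)
    (hΩb : Bornology.IsBounded Ω) (hθ : θm < θM) (hconvex : θM - θm < Real.pi) (hh : 0 < h)
    (hcorner : cylinder h M ∩ Ω = edgeCorner θm θM h M)
    (hface_m : face θm h M ⊆ Γ) (hface_M : face θM h M ⊆ Γ)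
    {lam mu rhoe rhob kappa omega : ℝ} {v : E3 → 𝕜} {Dv : Fin 3 → E3 → 𝕜} {u : Fin 3 → E3 → 𝕜}
    {Du : Fin 3 → Fin 3 → E3 → 𝕜}
    (hvu : SolvesTransmission Ω Γ lam mu rhoe rhob kappa omega v Dv u Du)
    {α₁ α₂ : ℝ≥0} (hα₁ : 0 < α₁) (hα₂ : 0 < α₂)
    (hu : ∀ i, IsC1Holder α₁ (closure (edgeCorner θm θM h M)) (u i))
    (hv : IsHolder α₂ (closure (edgeCorner θm θM h M)) v)
    {x₃ : ℝ} (hx₃ : x₃ ∈ Ioo (-M) M) (i : Fin 3) {j : Fin 3} (hj : j = 0 ∨ j = 1) :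
    stress lam mu
        (fun i j x => fderivWithin ℝ (u i) (closure (edgeCorner θm θM h M)) x (e j)) i j
        !₂[0, 0, x₃] + coordField i v j !₂[0, 0, x₃] = 0 := by
  set p : E3 := !₂[0, 0, x₃] with hp
  set V : Set E3 := edgeCorner θm θM h M with hV
  set DK : Fin 3 → Fin 3 → E3 → 𝕜 := fun i j x => fderivWithin ℝ (u i) (closure V) x (e j)
    with hDK
  have hs : 0 < Real.sin (θM - θm) := Real.sin_pos_of_pos_of_lt_pi (by linarith) hconvex
  have hneg : Real.sin (θm - θM) = -Real.sin (θM - θm) := by rw [← Real.sin_neg]; congr 1; ring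
  have hpK : p ∈ closure V := edge_mem_closure_edgeCorner hθ hconvex hh hx₃
  have hU : cylinder h M ∈ 𝓝 p := (isOpen_cylinder h M).mem_nhds (edge_mem_cylinder hh hx₃)
  have hVo : IsOpen V := by rw [← hcorner]; exact (isOpen_cylinder h M).inter hΩ
  have hVΩ : V ⊆ Ω := by rw [← hcorner]; exact inter_subset_right
  have hloc : ∀ x ∈ cylinder h M, x ∈ Ω ↔ 0 < angularForm θm x ∧ 0 < (-angularForm θM) x := by
    intro x hx
    have h1 : x ∈ cylinder h M ∩ Ω ↔ x ∈ V := by rw [hcorner]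
    rw [hV, edgeCorner_eq hθ hconvex hh] at h1
    exact ⟨fun hxΩ => (h1.1 ⟨hx, hxΩ⟩).2, fun hpos => (h1.2 ⟨hx, hpos⟩).2⟩
  have hfin : IsFiniteMeasure (volume.restrict Ω) := ⟨by
    rw [Measure.restrict_apply_univ]; exact hΩb.measure_lt_top⟩
  have hDu : ∀ i j, IntegrableOn (Du i j) Ω := fun i j =>
    ((hvu.h1_u i).memLp_grad j).integrable (by norm_num)
  have hui : IntegrableOn (fun x => -((omega ^ 2 * rhoe) • u i x)) Ω :=
    (((hvu.h1_u i).memLp.integrable (by norm_num)).smul (omega ^ 2 * rhoe)).neg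
  have hvi : IntegrableOn v Ω := hvu.h1_v.memLp.integrable (by norm_num)
  have hDvi : IntegrableOn (Dv i) Ω := (hvu.h1_v.memLp_grad i).integrable (by norm_num)
  have hcontD : ∀ i j, ContinuousWithinAt (DK i j) (closure V) p := by
    intro i j
    obtain ⟨C, hC⟩ := (hu i).2
    exact ((hC.continuousOn hα₁) p hpK).clm_apply continuousWithinAt_const
  have hcontv : ContinuousWithinAt v (closure V) p := by
    obtain ⟨C, hC⟩ := hv
    exact (hC.continuousOn hα₂) p hpK
  have hKΩ : closure V ∈ 𝓝[Ω] p := by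
    refine mem_of_superset (inter_mem_nhdsWithin Ω hU) ?_
    rw [inter_comm, hcorner]
    exact subset_closure
  have hcont : ∀ j, ContinuousWithinAt
      (fun x => stress lam mu DK i j x + coordField i v j x) Ω p := fun j =>
    ((continuousWithinAt_stress hcontD lam mu i j).add
      (continuousWithinAt_coordField hcontv i j)).mono_of_mem_nhdsWithin hKΩ
  have hDuDK : ∀ i j, ∀ᵐ x, x ∈ V → Du i j x = DK i j x := by
    intro i j
    filter_upwards [(hvu.h1_u i).ae_eq_fderiv hΩb hVo hVΩ ((hu i).1.mono subset_closure) j]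
      with x hx hxV
    rw [hx hxV, hDK]
    simp only
    rw [fderivWithin_of_mem_nhds (mem_of_superset (hVo.mem_nhds hxV) subset_closure)]
  have hww' : ∀ j, ∀ᵐ x ∂volume.restrict Ω, x ∈ cylinder h M →
      stress lam mu Du i j x + coordField i v j x =
        stress lam mu DK i j x + coordField i v j x := by
    intro j
    have hall : ∀ᵐ x ∂volume.restrict Ω, ∀ i j, x ∈ V → Du i j x = DK i j x :=
      ae_restrict_of_ae (ae_all_iff.2 fun i => ae_all_iff.2 fun j => hDuDK i j)
    filter_upwards [hall, ae_restrict_mem hΩ.measurableSet] with x hx hxΩ hxc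
    have hxV : x ∈ V := by rw [← hcorner]; exact ⟨hxc, hxΩ⟩
    have hx' : ∀ i j, Du i j x = DK i j x := fun i j => hx i j hxV
    simp only [stress, divergence, hx']
  have hwint : ∀ j, IntegrableOn (fun x => stress lam mu Du i j x + coordField i v j x) Ω :=
    fun j => (integrableOn_stress hDu lam mu i j).add (integrableOn_coordField hvi i j)
  have hweak : ∀ ψ : E3 → ℝ, ContDiff ℝ ∞ ψ → HasCompactSupport ψ → tsupport ψ ⊆ cylinder h M →
      normalPairing Ω (fun j x => stress lam mu Du i j x + coordField i v j x)
        (fun x => -((omega ^ 2 * rhoe) • u i x) + Dv i x) ψ = 0 := by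
    intro ψ hψ hψs hψU
    rw [normalPairing_add (integrableOn_stress hDu lam mu i) hui
      (integrableOn_coordField hvi i) hDvi hψ hψs]
    exact hvu.traction i ψ ⟨hψ, hψs, fun x hx =>
      (cylinder_inter_frontier_subset hΩ hθ hconvex hh hcorner ⟨hψU hx.1, hx.2⟩).elim
        (fun hxm => hface_m hxm) (fun hxM => hface_M hxM)⟩
  have hap : angularForm θm p = 0 := angularForm_apply_edge θm x₃
  have hbp : (-angularForm θM) p = 0 := by
    rw [neg_apply, hp, angularForm_apply_edge, neg_zero]
  set rm : E3 := !₂[Real.cos θm, Real.sin θm, 0] with hrm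
  set rM : E3 := !₂[Real.cos θM, Real.sin θM, 0] with hrM
  have hmm : angularForm θm rm = 0 := by rw [angularForm_apply_ray, sub_self, Real.sin_zero]
  have hmM : angularForm θm rM = Real.sin (θM - θm) := angularForm_apply_ray _ _
  have hMm : (-angularForm θM) rm = Real.sin (θM - θm) := by
    rw [neg_apply, angularForm_apply_ray, hneg, neg_neg]
  have hMM : (-angularForm θM) rM = 0 := by
    rw [neg_apply, angularForm_apply_ray, sub_self, Real.sin_zero, neg_zero]
  have hcm : 0 < angularForm θm (rm + rM) := by rw [map_add, hmm, hmM, zero_add]; exact hs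
  have hcM : 0 < (-angularForm θM) (rm + rM) := by rw [map_add, hMM, hMm, add_zero]; exact hs
  -- Translation along the ray of the face `θm` keeps the first form at zero; the factor normalizes
  -- the second form to `1`. The next application exchanges the roles of the faces.
  have hM0 := normal_component_eq_zero (angularForm θm) (-angularForm θM) hap hbp
    (d := (Real.sin (θM - θm))⁻¹ • rm) (by rw [map_smul, hmm, smul_zero])
    (by rw [map_smul, hMm, smul_eq_mul, inv_mul_cancel₀ hs.ne']) hcm hcM hΩ.measurableSet hU hloc
    hwint (hui.add hDvi) hww' hcont hweak
  have hm0 := normal_component_eq_zero (-angularForm θM) (angularForm θm) hbp hap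
    (d := (Real.sin (θM - θm))⁻¹ • rM) (by rw [map_smul, hMM, smul_zero])
    (by rw [map_smul, hmM, smul_eq_mul, inv_mul_cancel₀ hs.ne']) hcM hcm hΩ.measurableSet hU
    (fun x hx => (hloc x hx).trans and_comm)
    hwint (hui.add hDvi) hww' hcont hweak
  have := eq_zero_of_angularForm_eq_zero hs hm0 hM0
  rcases hj with rfl | rfl
  exacts [this.1, this.2]

end AcoustoElastic

end

/-! ### Linear algebra at the edge point. -/

open AcoustoElastic in
/-- Here `J i j` is the derivative of the component `u i` in the direction `e j` at the edge point
`p = (0, 0, x₃)`, with indices starting from `0`. -/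
theorem theorem3p1 {𝕜 : Type*} [RCLike 𝕜]
    (Ω Γ : Set E3) (hΩ : IsBoundedLipschitzDomain Ω)
    (θm θM h M : ℝ) (hθm : -Real.pi < θm) (hθ : θm < θM) (hθM : θM < Real.pi)
    (hconvex : θM - θm < Real.pi) (hh : 0 < h) (hM : 0 < M)
    (hcorner : cylinder h M ∩ Ω = edgeCorner θm θM h M)
    (hΓ : Γ ⊆ frontier Ω) (hface_m : face θm h M ⊆ Γ) (hface_M : face θM h M ⊆ Γ)
    (lam mu rhoe rhob kappa omega : ℝ)
    (hlam : 0 < 2 * lam + 3 * mu) (hmu : mu ≠ 0)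
    (hrhoe : 0 < rhoe) (hrhob : 0 < rhob) (hkappa : 0 < kappa) (homega : 0 < omega)
    (v : E3 → 𝕜) (u : Fin 3 → E3 → 𝕜)
    (hvu : IsTransmissionEigenpair Ω Γ lam mu rhoe rhob kappa omega v u)
    (α₁ α₂ : ℝ≥0) (hα₁ : 0 < α₁ ∧ α₁ < 1) (hα₂ : 0 < α₂ ∧ α₂ < 1)
    (hu : ∀ i, IsC1Holder α₁ (closure (edgeCorner θm θM h M)) (u i))
    (hv : IsHolder α₂ (closure (edgeCorner θm θM h M)) v)
    (x₃ : ℝ) (hx₃ : x₃ ∈ Set.Ioo (-M) M)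
    (p : E3) (hp : p = !₂[0, 0, x₃])
    (J : Matrix (Fin 3) (Fin 3) 𝕜) (hJ : J = gradMatrix (closure (edgeCorner θm θM h M)) u p) :
    strain (closure (edgeCorner θm θM h M)) u p = Matrix.diagonal ![J 0 0, J 1 1, J 2 2] ∧
    (J 2 2 = 0 → v p = -((2 * (lam + mu)) • J 0 0)) ∧
    (J 2 2 = 0 → J 0 0 = 0 → v p = 0) ∧
    (J 2 2 = 0 → J 0 0 = 0 → J 0 1 = 0 → J 0 2 = 0 → J 1 2 = 0 → J = 0) := by
  obtain ⟨⟨Dv, Du, hsol⟩, -⟩ := hvu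
  have key := fun (i j : Fin 3) (hj : j = 0 ∨ j = 1) =>
    stress_add_coordField_eq_zero hΩ.isOpen hΩ.isBounded hθ hconvex hh hcorner hface_m hface_M hsol
      hα₁.1 hα₂.1 hu hv hx₃ i hj
  have hJij : ∀ i j, fderivWithin ℝ (u i) (closure (edgeCorner θm θM h M)) p (e j) = J i j :=
    fun i j => by rw [hJ]; rfl
  have hmu' : (mu : 𝕜) ≠ 0 := RCLike.ofReal_ne_zero.2 hmu
  have k00 := key 0 0 (Or.inl rfl)
  have k11 := key 1 1 (Or.inr rfl)
  have k10 := key 1 0 (Or.inl rfl)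
  have k20 := key 2 0 (Or.inl rfl)
  have k21 := key 2 1 (Or.inr rfl)
  rw [← hp] at k00 k11 k10 k20 k21
  simp only [stress, coordField, divergence, hJij, Fin.sum_univ_three, Fin.reduceEq, if_true,
    if_false, RCLike.real_smul_eq_coe_mul, add_zero, zero_add] at k00 k11 k10 k20 k21
  push_cast at k00 k11 k10 k20 k21
  -- Off the diagonal the stress is `μ (J i j + J j i)`; in the difference of the first two diagonal
  -- equations `v` and the divergence cancel, leaving `2 μ (J 0 0 - J 1 1)`.
  have h01 : J 0 1 + J 1 0 = 0 := (mul_eq_zero_iff_left hmu').1 (by linear_combination k10)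
  have h02 : J 0 2 + J 2 0 = 0 := (mul_eq_zero_iff_left hmu').1 (by linear_combination k20)
  have h12 : J 1 2 + J 2 1 = 0 := (mul_eq_zero_iff_left hmu').1 (by linear_combination k21)
  have hdiag : J 0 0 - J 1 1 = 0 :=
    (mul_eq_zero_iff_left (mul_ne_zero two_ne_zero hmu')).1 (by linear_combination k00 - k11)
  have hb : J 2 2 = 0 → v p = -((2 * (lam + mu)) • J 0 0) := by
    intro h22
    rw [RCLike.real_smul_eq_coe_mul]
    push_cast
    linear_combination k00 - (lam : 𝕜) * h22 + (lam : 𝕜) * hdiag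
  refine ⟨?_, hb, fun h22 h00 => by rw [hb h22, h00, smul_zero, neg_zero], ?_⟩
  · ext i j
    have hS : strain (closure (edgeCorner θm θM h M)) u p i j = (1 / 2 : 𝕜) * (J i j + J j i) := by
      rw [strain, ← hJ, Matrix.smul_apply, RCLike.real_smul_eq_coe_mul]
      push_cast
      rfl
    rw [hS, Matrix.diagonal_apply]
    fin_cases i <;> fin_cases j <;> simp <;>
      first
      | ring1
      | linear_combination h01
      | linear_combination h02
      | linear_combination h12
  · intro h22 h00 h1 h2 h3
    ext i j
    fin_cases i <;> fin_cases j <;> simp [h22, h00, h1, h2, h3]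
    · linear_combination h01 - h1
    · linear_combination h00 - hdiag
    · linear_combination h02 - h2
    · linear_combination h12 - h3
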